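/- Call a finite poset \emph{graded} if all of its maximal chains have the same length. Say that a poset $P$ avoids a poset $Q$ if no subset of $P$, with the induced order, is isomorphic to $Q$, and let $(a+b)$ denote the disjoint union of a chain with $a$ elements and a chain with $b$ elements, with every element of one chain incomparable to every element of the other. A \emph{graded semiorder} is a finite graded poset that is both $(2+2)$-avoiding and $(3+1)$-avoiding. For $n \ge 0$ let $o_n$ be the number of isomorphism classes of graded semiorders with $n$ elements (the empty poset counts, so $o_0 = 1$). Then, as formal power series, \[ \sum_{n \ge 0} o_n x^n = \frac{1-3x+2x^2-x^3}{(1-x)(1-3x+x^2)}. \] -/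

import Mathlib

namespace GradedSemiorder

/-- `P` avoids `Q`: no set of elements of `P`, with the induced order, is isomorphic to `Q`. -/
def Avoids (P Q : Type*) [PartialOrder P] [PartialOrder Q] : Prop :=
  IsEmpty (Q ↪o P)

/-- `P` is an interval order: it avoids `2 + 2`, the disjoint union of two incomparable chains
of two elements each (the order on `⊕` makes elements of different summands incomparable). -/
def IsIntervalOrder (P : Type*) [PartialOrder P] : Prop :=
  Avoids P (Fin 2 ⊕ Fin 2)

/-- `P` is a semiorder: it avoids both `2 + 2` and `3 + 1`. -/
def IsSemiorder (P : Type*) [PartialOrder P] : Prop :=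
  IsIntervalOrder P ∧ Avoids P (Fin 3 ⊕ Fin 1)

/-- `P` is (strongly) graded: all maximal chains of `P` have the same number of elements. -/
def IsGraded (P : Type*) [PartialOrder P] : Prop :=
  ∀ s t : Set P, IsMaxChain (· ≤ ·) s → IsMaxChain (· ≤ ·) t → s.encard = t.encard

/-- The partial orders on `{0, …, n - 1}` that are graded semiorders. The order is always the
given one `p`, never the usual order of `Fin n`. -/
def Labeled (n : ℕ) : Type :=
  {p : PartialOrder (Fin n) // @IsGraded (Fin n) p ∧ @IsSemiorder (Fin n) p}

/-- Two graded semiorders on `{0, …, n - 1}` are equivalent if they are isomorphic posets. -/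
def isoSetoid (n : ℕ) : Setoid (Labeled n) where
  r p q := Nonempty (@OrderIso (Fin n) (Fin n) p.1.toLE q.1.toLE)
  iseqv :=
    { refl := fun p => ⟨@OrderIso.refl (Fin n) p.1.toLE⟩
      symm := fun {p q} ⟨e⟩ => ⟨@OrderIso.symm (Fin n) (Fin n) p.1.toLE q.1.toLE e⟩
      trans := fun {p q r} ⟨e⟩ ⟨f⟩ =>
        ⟨@OrderIso.trans (Fin n) (Fin n) (Fin n) p.1.toLE q.1.toLE r.1.toLE e f⟩ }

/-- An unlabeled graded semiorder of size `n` is an isomorphism class. -/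
def Unlabeled (n : ℕ) : Type :=
  Quotient (isoSetoid n)

/-- The number of unlabeled graded semiorders of size `n`. -/
noncomputable def numUnlabeled (n : ℕ) : ℕ :=
  Nat.card (Unlabeled n)

/-- The ordinary generating function of unlabeled graded semiorders. -/
noncomputable def ogf : PowerSeries ℚ :=
  PowerSeries.mk fun n => (numUnlabeled n : ℚ)

end GradedSemiorder

/-! A semiorder can be numbered so that every strict lower set is an initial segment. It then
becomes a monotone sequence `F` with `F i ≤ i`, the sorted list of the sizes of its strict lower
sets, which determines the isomorphism class (`IsSemiorder.exists_isRep`, `IsRep.eq_of_orderIso`).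

Gradedness amounts to a rank function that is constant on maximal elements. In terms of `F` the rank
has to be `lvl F`, which is monotone; lower covers and maximal elements are numbered by intervals,
so it suffices to compare `lvl F` at the two ends of each (`IsRep.isGraded_iff`).

Such sequences can be recognised term by term. What matters is how far the last term falls short of
the start `L` of the current level and, if it does not, how many terms equal `L`
(`State.mem_words_iff`). The resulting linear recursion has the explicit solution `completions`, and
the total is 1 + x/(1-x) + x²/(1-3x+x²). -/

namespace GradedSemiorder

/-! ### Gradedness and rank functions -/

section Rank

variable {P : Type*} [PartialOrder P]

theorem isMaxChain_iff {s : Set P} :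
    IsMaxChain (· ≤ ·) s ↔
      IsChain (· ≤ ·) s ∧ ∀ z, (∀ y ∈ s, z ≤ y ∨ y ≤ z) → z ∈ s := by
  constructor
  · rintro ⟨hs, hm⟩
    refine ⟨hs, fun z hz => ?_⟩
    have : s = insert z s := hm (hs.insert fun y hy _ => hz y hy) (Set.subset_insert z s)
    rw [this]
    exact Set.mem_insert z s
  · rintro ⟨hs, hm⟩
    refine ⟨hs, fun t ht hst => hst.antisymm fun z hz => hm z fun y hy => ?_⟩
    exact ht.total hz (hst hy)

/-- An element comparable to the whole glued chain is comparable to `x`, hence by transitivity to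
the half of either chain on the other side of `x`. Maximality of the chain on its own side captures
it. -/
theorem isMaxChain_glue {s t : Set P} (hs : IsMaxChain (· ≤ ·) s) (ht : IsMaxChain (· ≤ ·) t)
    {x : P} (hxs : x ∈ s) (hxt : x ∈ t) :
    IsMaxChain (· ≤ ·) (s ∩ Set.Iio x ∪ t ∩ Set.Ici x) := by
  rw [isMaxChain_iff] at *
  constructor
  · rintro a (⟨ha, hax⟩ | ⟨ha, hax⟩) b (⟨hb, hbx⟩ | ⟨hb, hbx⟩) _
    · exact hs.1.total ha hb
    · exact Or.inl (hax.le.trans hbx)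
    · exact Or.inr (hbx.le.trans hax)
    · exact ht.1.total ha hb
  · intro z hz
    rcases eq_or_ne z x with rfl | hne
    · exact Or.inr ⟨hxt, le_rfl⟩
    rcases hz x (Or.inr ⟨hxt, le_rfl⟩) with h | h
    · refine Or.inl ⟨hs.2 z fun y hy => ?_, lt_of_le_of_ne h hne⟩
      rcases eq_or_ne y x with rfl | hyx
      · exact Or.inl h
      rcases hs.1.total hy hxs with h' | h'
      · exact hz y (Or.inl ⟨hy, lt_of_le_of_ne h' hyx⟩)
      · exact Or.inl (h.trans h')
    · refine Or.inr ⟨ht.2 z fun y hy => ?_, h⟩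
      rcases ht.1.total hy hxt with h' | h'
      · exact Or.inr (h'.trans h)
      · exact hz y (Or.inr ⟨hy, h'⟩)

theorem ncard_Iio_add_ncard_Ici [Finite P] (s t : Set P) (x : P) :
    (s ∩ Set.Iio x ∪ t ∩ Set.Ici x).ncard = (s ∩ Set.Iio x).ncard + (t ∩ Set.Ici x).ncard := by
  apply Set.ncard_union_eq _ (Set.toFinite _) (Set.toFinite _)
  rw [Set.disjoint_left]
  rintro a ⟨_, h⟩ ⟨_, h'⟩
  exact absurd h (not_lt_of_ge h')

/-- `r` is a rank function of height `h`. -/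
structure IsRank (r : P → ℕ) (h : ℕ) : Prop where
  bot : ∀ x, IsMin x → r x = 0
  covBy : ∀ x y, x ⋖ y → r y = r x + 1
  top : ∀ x, IsMax x → r x = h

/-- The rank of `x` counts the elements below `x` in a maximal chain through `x`. Exchanging the
parts of two such chains below `x` shows that the choice of chain is irrelevant. -/
theorem IsGraded.exists_isRank [Finite P] (hP : IsGraded P) :
    ∃ (r : P → ℕ) (h : ℕ), IsRank r h := by
  have ex (c : Set P) (hc : IsChain (· ≤ ·) c) : ∃ s, IsMaxChain (· ≤ ·) s ∧ c ⊆ s :=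
    hc.exists_maxChain
  choose m hm hxm using fun x : P => ex {x} Set.subsingleton_singleton.isChain
  have hxm' (x : P) : x ∈ m x := hxm x rfl
  have key (s t : Set P) (hs : IsMaxChain (· ≤ ·) s) (ht : IsMaxChain (· ≤ ·) t) (x : P)
      (hxs : x ∈ s) (hxt : x ∈ t) : (s ∩ Set.Iio x).ncard = (t ∩ Set.Iio x).ncard := by
    have h1 := congrArg ENat.toNat (hP _ _ (isMaxChain_glue hs ht hxs hxt)
      (isMaxChain_glue ht ht hxt hxt))
    change Set.ncard _ = Set.ncard _ at h1
    rw [ncard_Iio_add_ncard_Ici, ncard_Iio_add_ncard_Ici] at h1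
    omega
  obtain ⟨s₀, hs₀, -⟩ := ex ∅ (by simp)
  refine ⟨fun x => (m x ∩ Set.Iio x).ncard, s₀.ncard - 1, ?_, ?_, ?_⟩
  · intro x hx
    convert Set.ncard_empty P
    ext y
    simp only [Set.mem_inter_iff, Set.mem_Iio, Set.mem_empty_iff_false, iff_false, not_and]
    exact fun _ h => hx.not_lt h
  · intro x y hxy
    obtain ⟨s, hs, hc⟩ := ex {x, y} (IsChain.pair hxy.le)
    have hx : x ∈ s := hc (by simp)
    have hy : y ∈ s := hc (by simp)
    rw [key _ s (hm y) hs y (hxm' y) hy, key _ s (hm x) hs x (hxm' x) hx,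
      ← Set.ncard_insert_of_notMem (a := x) (by simp) (Set.toFinite _)]
    congr 1
    ext z
    simp only [Set.mem_inter_iff, Set.mem_Iio, Set.mem_insert_iff]
    constructor
    · rintro ⟨hz, hzy⟩
      rcases eq_or_ne z x with rfl | hne
      · exact Or.inl rfl
      rcases hs.1.total hz hx with h | h
      · exact Or.inr ⟨hz, lt_of_le_of_ne h hne⟩
      · exact absurd hzy (hxy.2 (lt_of_le_of_ne h hne.symm))
    · rintro (rfl | ⟨hz, h⟩)
      · exact ⟨hx, hxy.lt⟩
      · exact ⟨hz, h.trans hxy.lt⟩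
  · intro x hx
    have h1 : m x ∩ Set.Iio x = m x \ {x} := by
      ext z
      simp only [Set.mem_inter_iff, Set.mem_Iio, Set.mem_sdiff, Set.mem_singleton_iff]
      refine and_congr_right fun hz => ⟨ne_of_lt, fun hne => ?_⟩
      rcases (hm x).1.total hz (hxm' x) with h | h
      · exact lt_of_le_of_ne h hne
      · exact absurd (hx.eq_of_le h).symm hne
    have h2 : (m x).ncard = s₀.ncard := congrArg ENat.toNat (hP _ _ (hm x) hs₀)
    simp only [h1]
    rw [Set.ncard_sdiff_singleton_of_mem (hxm' x), h2]

/-- Consecutive elements of a maximal chain are covers and its least element is minimal, so the rank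
counts steps along the chain. -/
theorem IsRank.ncard_Iio [Finite P] {r : P → ℕ} {h : ℕ} (hr : IsRank r h) {s : Set P}
    (hs : IsMaxChain (· ≤ ·) s) (x : P) : x ∈ s → (s ∩ Set.Iio x).ncard = r x := by
  have hs' := isMaxChain_iff.1 hs
  induction x using (wellFounded_lt (α := P)).induction with
  | _ x ih =>
  intro hx
  by_cases he : (s ∩ Set.Iio x).Nonempty
  · obtain ⟨y, ⟨hys, hyx⟩, hmax⟩ := (Set.toFinite (s ∩ Set.Iio x)).exists_maximal he
    have hle (z : P) (hz : z ∈ s) (hzx : z < x) : z ≤ y := by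
      rcases hs.1.total hz hys with h | h
      · exact h
      · exact hmax ⟨hz, hzx⟩ h
    have hcov : y ⋖ x := by
      refine ⟨hyx, fun z hyz hzx => ?_⟩
      have : z ∈ s := by
        refine hs'.2 z fun w hw => ?_
        rcases hs.1.total hw hx with h | h
        · rcases eq_or_lt_of_le h with rfl | h
          · exact Or.inl hzx.le
          · exact Or.inr ((hle w hw h).trans hyz.le)
        · exact Or.inl (hzx.le.trans h)
      exact absurd (hle z this hzx) (not_le_of_gt hyz)
    rw [hr.covBy y x hcov, ← ih y hyx hys,
      ← Set.ncard_insert_of_notMem (a := y) (by simp) (Set.toFinite _)]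
    congr 1
    ext z
    simp only [Set.mem_inter_iff, Set.mem_Iio, Set.mem_insert_iff]
    constructor
    · rintro ⟨hz, hzx⟩
      rcases eq_or_lt_of_le (hle z hz hzx) with h | h
      · exact Or.inl h
      · exact Or.inr ⟨hz, h⟩
    · rintro (rfl | ⟨hz, h⟩)
      · exact ⟨hys, hyx⟩
      · exact ⟨hz, h.trans hyx⟩
  · rw [hr.bot x, Set.not_nonempty_iff_eq_empty.1 he, Set.ncard_empty]
    intro z hz
    by_contra hxz
    have hlt : z < x := lt_of_le_not_ge hz hxz
    refine he ⟨z, hs'.2 z fun w hw => ?_, hlt⟩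
    rcases hs.1.total hw hx with h | h
    · rcases eq_or_lt_of_le h with rfl | h
      · exact Or.inl hz
      · exact absurd ⟨w, hw, h⟩ he
    · exact Or.inl (hz.trans h)

theorem IsRank.ncard_eq [Finite P] [Nonempty P] {r : P → ℕ} {h : ℕ} (hr : IsRank r h) {s : Set P}
    (hs : IsMaxChain (· ≤ ·) s) : s.ncard = h + 1 := by
  have hs' := isMaxChain_iff.1 hs
  have hne : s.Nonempty := by
    by_contra hne
    rw [Set.not_nonempty_iff_eq_empty] at hne
    have := hs'.2 (Classical.arbitrary P) (by simp [hne])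
    simp [hne] at this
  obtain ⟨x, hx, hmax⟩ := (Set.toFinite s).exists_maximal hne
  have hle (z : P) (hz : z ∈ s) : z ≤ x := by
    rcases hs.1.total hz hx with h | h
    · exact h
    · exact hmax hz h
  have hxmax : IsMax x := by
    intro z hz
    exact hle z (hs'.2 z fun w hw => Or.inr ((hle w hw).trans hz))
  rw [← hr.top x hxmax, ← hr.ncard_Iio hs x hx,
    ← Set.ncard_insert_of_notMem (a := x) (by simp) (Set.toFinite _)]
  congr 1
  ext z
  simp only [Set.mem_inter_iff, Set.mem_Iio, Set.mem_insert_iff]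
  constructor
  · intro hz
    rcases eq_or_lt_of_le (hle z hz) with h | h
    · exact Or.inl h
    · exact Or.inr ⟨hz, h⟩
  · rintro (rfl | ⟨hz, _⟩)
    · exact hx
    · exact hz

theorem IsRank.isGraded [Finite P] {r : P → ℕ} {h : ℕ} (hr : IsRank r h) : IsGraded P := by
  intro s t hs ht
  cases isEmpty_or_nonempty P
  · rw [Subsingleton.elim s t]
  · rw [← (Set.toFinite s).cast_ncard_eq, ← (Set.toFinite t).cast_ncard_eq, hr.ncard_eq hs,
      hr.ncard_eq ht]

end Rank


/-! ### Semiorders as monotone sequences -/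

section Avoidance

variable {P : Type*} [PartialOrder P]

theorem isIntervalOrder_iff :
    IsIntervalOrder P ↔ ∀ a b c d : P, a < b → c < d → a < d ∨ c < b := by
  constructor
  · intro h a b c d hab hcd
    by_contra! hn
    obtain ⟨had, hcb⟩ := hn
    have hac : ¬ a ≤ c := fun h => had (h.trans_lt hcd)
    have hca : ¬ c ≤ a := fun h => hcb (h.trans_lt hab)
    have hbd : ¬ b ≤ d := fun h => had (hab.trans_le h)
    have hdb : ¬ d ≤ b := fun h => hcb (hcd.trans_le h)
    have had' : ¬ a ≤ d := fun h => hdb ((h.eq_of_not_lt had) ▸ hab.le)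
    have hcb' : ¬ c ≤ b := fun h => hbd ((h.eq_of_not_lt hcb) ▸ hcd.le)
    have hda : ¬ d ≤ a := fun h => hdb (h.trans hab.le)
    have hbc : ¬ b ≤ c := fun h => hbd (h.trans hcd.le)
    refine h.false (OrderEmbedding.ofMapLEIff (Sum.elim ![a, b] ![c, d]) ?_)
    rintro (i | i) (j | j) <;> fin_cases i <;> fin_cases j <;>
      simp [hab.le, hcd.le, hab.not_ge, hcd.not_ge, *]
  · refine fun h => ⟨fun e => ?_⟩
    have h1 := h (e (.inl 0)) (e (.inl 1)) (e (.inr 0)) (e (.inr 1))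
      (e.lt_iff_lt.2 (by simp)) (e.lt_iff_lt.2 (by simp))
    simp at h1

theorem avoids_three_one_iff :
    Avoids P (Fin 3 ⊕ Fin 1) ↔ ∀ a b c d : P, a < b → b < c → a < d ∨ d < c := by
  constructor
  · intro h a b c d hab hbc
    by_contra! hn
    obtain ⟨had, hdc⟩ := hn
    have hda : ¬ d ≤ a := fun h => hdc (h.trans_lt (hab.trans hbc))
    have hcd : ¬ c ≤ d := fun h => had ((hab.trans hbc).trans_le h)
    have hdb : ¬ d ≤ b := fun h => hdc (h.trans_lt hbc)
    have hbd : ¬ b ≤ d := fun h => had (hab.trans_le h)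
    have had' : ¬ a ≤ d := fun h => hda (h.eq_of_not_lt had).ge
    have hdc' : ¬ d ≤ c := fun h => hcd (h.eq_of_not_lt hdc).ge
    refine h.false (OrderEmbedding.ofMapLEIff (Sum.elim ![a, b, c] ![d]) ?_)
    rintro (i | i) (j | j) <;> fin_cases i <;> fin_cases j <;>
      simp [hab.le, hbc.le, hab.not_ge, hbc.not_ge, (hab.trans hbc).le, (hab.trans hbc).not_ge, *]
  · refine fun h => ⟨fun e => ?_⟩
    have h1 := h (e (.inl 0)) (e (.inl 1)) (e (.inl 2)) (e (.inr 0))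
      (e.lt_iff_lt.2 (by simp)) (e.lt_iff_lt.2 (by simp))
    simp at h1

/-- In the first case an `l` below `j` but not below `k` extends `j < i` to a three-element chain,
and 3+1 is avoided. In the second, if `k < i` failed, some `i'` would lie above `k` but not above
`j`, and the pairs `j < i`, `k < i'` would form 2+2. -/
theorem IsSemiorder.lt_of_ncard [Finite P] (hP : IsSemiorder P) {i j k : P} (hji : j < i)
    (h : (Set.Iio k).ncard < (Set.Iio j).ncard ∨ (Set.Ioi j).ncard ≤ (Set.Ioi k).ncard) :
    k < i := by
  have hP1 := isIntervalOrder_iff.1 hP.1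
  have hP2 := avoids_three_one_iff.1 hP.2
  by_contra hki
  rcases h with h | h
  · obtain ⟨l, hlj, hlk⟩ := Set.exists_mem_notMem_of_ncard_lt_ncard h
    exact (hP2 l j i k hlj hji).elim hlk hki
  · obtain ⟨i', hi', hji'⟩ : ∃ i', k < i' ∧ ¬ j < i' := by
      by_contra! hn
      have hss : Set.Ioi k ⊂ Set.Ioi j := (Set.ssubset_iff_of_subset hn).2 ⟨i, hji, hki⟩
      exact absurd (Set.ncard_lt_ncard hss) (not_lt_of_ge h)
    exact (hP1 j i k i' hji hi').elim hji' hki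

end Avoidance

/-- `F` describes the order of `P` through the numbering `idx`: the strict lower set of the element
numbered `i` consists of the elements numbered `0, …, F i - 1`. -/
structure IsRep {P : Type*} [PartialOrder P] {n : ℕ} (idx : P ≃ Fin n) (F : ℕ → ℕ) : Prop where
  mono : Monotone F
  le_self : ∀ i, F i ≤ i
  lt_iff : ∀ x y, x < y ↔ (idx x : ℕ) < F (idx y)

theorem IsRep.isSemiorder {P : Type*} [PartialOrder P] {n : ℕ} {idx : P ≃ Fin n} {F : ℕ → ℕ}
    (h : IsRep idx F) : IsSemiorder P := by
  refine ⟨isIntervalOrder_iff.2 fun a b c d => ?_, avoids_three_one_iff.2 fun a b c d => ?_⟩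
  · simp only [h.lt_iff]
    intro hab hcd
    rcases le_total (idx b : ℕ) (idx d) with hbd | hbd
    · exact Or.inl (hab.trans_le (h.mono hbd))
    · exact Or.inr (hcd.trans_le (h.mono hbd))
  · simp only [h.lt_iff]
    intro hab hbc
    by_contra! hn
    have h1 : (idx b : ℕ) ≤ idx d := hbc.le.trans hn.2
    have h2 := h.mono h1
    omega

theorem IsRep.ncard_Iio {P : Type*} [PartialOrder P] {n : ℕ} {idx : P ≃ Fin n} {F : ℕ → ℕ}
    (h : IsRep idx F) (x : P) : (Set.Iio x).ncard = F (idx x) := by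
  have h1 : Set.Iio x = (fun y => (idx y : ℕ)) ⁻¹' Set.Iio (F (idx x)) := by
    ext y
    simp [h.lt_iff]
  have hlt := (h.le_self (idx x)).trans_lt (idx x).2
  rw [h1, Set.ncard_preimage_of_injective_subset_range]
  · rw [← Nat.card_coe_set_eq]; simp
  · exact fun a b hab => idx.injective (Fin.ext hab)
  · intro i hi
    exact ⟨idx.symm ⟨i, lt_trans hi hlt⟩, by simp⟩

theorem lt_ncard_iff_mem {n : ℕ} {S : Set (Fin n)} (hS : IsLowerSet S) (i : Fin n) :
    (i : ℕ) < S.ncard ↔ i ∈ S := by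
  constructor
  · intro hi
    by_contra hn
    have hsub : S ⊆ Set.Iio i := fun j hj => lt_of_not_ge fun hij => hn (hS hij hj)
    have := Set.ncard_le_ncard hsub
    rw [← Nat.card_coe_set_eq (Set.Iio i)] at this
    simp at this
    omega
  · intro hi
    have hsub : Set.Iic i ⊆ S := fun j hj => hS hj hi
    have := Set.ncard_le_ncard hsub
    rw [← Nat.card_coe_set_eq (Set.Iic i)] at this
    simp at this
    omega

theorem IsSemiorder.exists_isRep {n : ℕ} {P : Type*} [PartialOrder P] (e : P ≃ Fin n)
    (hP : IsSemiorder P) : ∃ (idx : P ≃ Fin n) (F : ℕ → ℕ), IsRep idx F ∧ ∀ i, n ≤ i → F i = i := by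
  have : Finite P := Finite.of_equiv _ e.symm
  -- Smaller strict lower sets come first, and ties go to the larger strict upper set; this is the
  -- comparison that `IsSemiorder.lt_of_ncard` needs to make lower sets initial segments.
  let key : Fin n → ℕ ×ₗ ℕ := fun i =>
    toLex ((Set.Iio (e.symm i)).ncard, n - (Set.Ioi (e.symm i)).ncard)
  let σ := Tuple.sort key
  have hσ : Monotone (key ∘ σ) := Tuple.monotone_sort key
  let idx : P ≃ Fin n := e.trans σ.symm
  have hkey (x y : P) (hxy : idx x ≤ idx y) : (Set.Iio x).ncard < (Set.Iio y).ncard ∨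
      (Set.Iio x).ncard = (Set.Iio y).ncard ∧ (Set.Ioi y).ncard ≤ (Set.Ioi x).ncard := by
    have h1 := hσ hxy
    simp only [key, idx, Function.comp_apply, Prod.Lex.toLex_le_toLex, Equiv.trans_apply,
      Equiv.apply_symm_apply, Equiv.symm_apply_apply] at h1
    have hn (z : P) : (Set.Ioi z).ncard ≤ n := by
      have := Set.ncard_le_card (Set.Ioi z)
      rwa [Nat.card_congr e, Nat.card_fin] at this
    have := hn x
    have := hn y
    omega
  have hmono (x y : P) (hxy : idx x ≤ idx y) : (Set.Iio x).ncard ≤ (Set.Iio y).ncard := by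
    have := hkey x y hxy
    omega
  have hlt (x y : P) : x < y ↔ (idx x : ℕ) < (Set.Iio y).ncard := by
    have hlow : IsLowerSet (idx '' Set.Iio y) := by
      rintro _ b hb ⟨j, hj, rfl⟩
      refine ⟨idx.symm b, ?_, by simp⟩
      have := hkey (idx.symm b) j (by simpa using hb)
      exact hP.lt_of_ncard hj (this.imp_right And.right)
    rw [← Set.ncard_image_of_injective _ idx.injective, lt_ncard_iff_mem hlow]
    simp
  have hle (x : P) : (Set.Iio x).ncard ≤ idx x := by
    have := hlt x x
    simpa using this
  refine ⟨idx, fun i => if h : i < n then (Set.Iio (idx.symm ⟨i, h⟩)).ncard else i,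
    ⟨?_, ?_, ?_⟩, ?_⟩
  · intro i j hij
    dsimp only
    split_ifs with hi hj hj
    · exact hmono _ _ (by simpa using hij)
    · have := hle (idx.symm ⟨i, hi⟩)
      simp only [Equiv.apply_symm_apply] at this
      omega
    · omega
    · exact hij
  · intro i
    split_ifs with hi
    · simpa using hle (idx.symm ⟨i, hi⟩)
    · exact le_rfl
  · intro x y
    simp [hlt]
  · intro i hi
    simp [not_lt.2 hi]


/-! ### Levels and gradedness of a sequence -/

/-- The length of the longest chain that ends at `i`, for the order in which `j` is below `i` when
`j < F i`. -/
def lvl (F : ℕ → ℕ) (i : ℕ) : ℕ :=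
  if _h : F i ≠ 0 ∧ F i ≤ i then lvl F (F i - 1) + 1 else 0
termination_by i

/-- All maximal elements of the initial segment with `v` elements have the same level. -/
def Flat (F : ℕ → ℕ) (v : ℕ) : Prop :=
  lvl F (F (v - 1)) = lvl F (v - 1)

/-- The condition on `F` for the order it describes on `n` elements to be graded. -/
def GradedSeq (F : ℕ → ℕ) (n : ℕ) : Prop :=
  (∀ i < n, 0 < F i → Flat F (F i)) ∧ (0 < n → Flat F n)

section Level

variable {F : ℕ → ℕ}

theorem lvl_of_eq_zero {i : ℕ} (h : F i = 0) : lvl F i = 0 := by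
  rw [lvl, dif_neg (by simp [h])]

theorem lvl_of_pos (hF : ∀ i, F i ≤ i) {i : ℕ} (h : 0 < F i) :
    lvl F i = lvl F (F i - 1) + 1 := by
  rw [lvl, dif_pos ⟨h.ne', hF i⟩]

theorem lvl_mono (hm : Monotone F) (hF : ∀ i, F i ≤ i) : Monotone (lvl F) := by
  intro i j hij
  induction j using Nat.strong_induction_on generalizing i with
  | _ j ih =>
  rcases Nat.eq_zero_or_pos (F i) with h | h
  · simp [lvl_of_eq_zero h]
  · have h1 := hm hij
    have h2 := hF j
    rw [lvl_of_pos hF h, lvl_of_pos hF (h.trans_le h1)]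
    exact Nat.succ_le_succ (ih _ (by omega) (by omega))

end Level

section Graded

variable {P : Type*} [PartialOrder P] {n : ℕ} {idx : P ≃ Fin n} {F : ℕ → ℕ}

theorem IsRep.isMin_iff (h : IsRep idx F) (x : P) : IsMin x ↔ F (idx x) = 0 := by
  have : Finite P := Finite.of_equiv _ idx.symm
  rw [← h.ncard_Iio, Set.ncard_eq_zero, Set.Iio_eq_empty_iff]

theorem IsRep.isMax_iff (h : IsRep idx F) (x : P) : IsMax x ↔ F (n - 1) ≤ idx x := by
  rw [isMax_iff_forall_not_lt]
  simp only [h.lt_iff, not_lt]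
  have hx := (idx x).2
  constructor
  · intro hx'
    simpa using hx' (idx.symm ⟨n - 1, by omega⟩)
  · intro hx' y
    exact (h.mono (by have := (idx y).2; omega)).trans hx'

/-- Among the elements below `y`, the one numbered `F (idx y) - 1` has the largest strict lower set,
so only that set has to be avoided. -/
theorem IsRep.covBy_iff (h : IsRep idx F) (x y : P) :
    x ⋖ y ↔ F (F (idx y) - 1) ≤ idx x ∧ (idx x : ℕ) < F (idx y) := by
  have hy := (idx y).2
  have hy' := h.le_self (idx y)
  constructor
  · rintro ⟨hxy, hn⟩
    rw [h.lt_iff] at hxy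
    refine ⟨?_, hxy⟩
    by_contra! hlt
    refine hn (c := idx.symm ⟨F (idx y) - 1, by omega⟩) ?_ ?_
    · simpa [h.lt_iff] using hlt
    · simp only [h.lt_iff, Equiv.apply_symm_apply]
      omega
  · rintro ⟨h1, h2⟩
    refine ⟨(h.lt_iff _ _).2 h2, fun z hxz hzy => ?_⟩
    rw [h.lt_iff] at hxz hzy
    have := h.mono (a := idx z) (b := F (idx y) - 1) (by omega)
    omega

theorem IsRep.gradedSeq_of_isRank (h : IsRep idx F) {r : P → ℕ} {t : ℕ} (hr : IsRank r t) :
    GradedSeq F n := by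
  have hlvl (i : ℕ) (hi : i < n) : lvl F i = r (idx.symm ⟨i, hi⟩) := by
    induction i using Nat.strong_induction_on with
    | _ i ih =>
    have hle := h.le_self i
    rcases Nat.eq_zero_or_pos (F i) with h0 | h0
    · rw [lvl_of_eq_zero h0, hr.bot _ ((h.isMin_iff _).2 (by simpa using h0))]
    · rw [lvl_of_pos h.le_self h0, ih _ (by omega) (by omega)]
      refine (hr.covBy _ _ ((h.covBy_iff _ _).2 ?_)).symm
      simp only [Equiv.apply_symm_apply]
      exact ⟨h.le_self _, by omega⟩
  constructor
  · intro i hi h0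
    have hle := h.le_self i
    have hle' := h.le_self (F i - 1)
    -- The lower covers of `i` run from `F (F i - 1)` to `F i - 1`; flatness compares the ranks of
    -- the two ends.
    have h1 := hr.covBy (idx.symm ⟨F (F i - 1), by omega⟩) (idx.symm ⟨i, hi⟩)
      ((h.covBy_iff _ _).2 (by simp only [Equiv.apply_symm_apply]; omega))
    rw [← hlvl, ← hlvl, lvl_of_pos h.le_self h0] at h1
    exact (Nat.succ_injective h1).symm
  · intro hn
    have hle := h.le_self (n - 1)
    rw [Flat, hlvl _ (by omega), hlvl _ (by omega), hr.top _ ((h.isMax_iff _).2 (by simp)),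
      hr.top _ ((h.isMax_iff _).2 (by simpa using hle))]

theorem IsRep.isRank_of_gradedSeq (h : IsRep idx F) (hg : GradedSeq F n) :
    IsRank (fun x => lvl F (idx x)) (lvl F (n - 1)) := by
  have hm := lvl_mono h.mono h.le_self
  refine ⟨fun x hx => lvl_of_eq_zero ((h.isMin_iff x).1 hx), fun x y hxy => ?_, fun x hx => ?_⟩
  · rw [h.covBy_iff] at hxy
    have h0 : 0 < F (idx y) := by omega
    have h1 := hg.1 _ (idx y).2 h0
    have h2 := hm hxy.1
    have h3 := hm (a := idx x) (b := F (idx y) - 1) (by omega)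
    rw [Flat] at h1
    rw [lvl_of_pos h.le_self h0]
    omega
  · rw [h.isMax_iff] at hx
    have hxn := (idx x).2
    have h1 := hg.2 (by omega)
    have h2 := hm hx
    have h3 := hm (a := idx x) (b := n - 1) (by omega)
    rw [Flat] at h1
    omega

theorem IsRep.isGraded_iff (h : IsRep idx F) : IsGraded P ↔ GradedSeq F n := by
  have : Finite P := Finite.of_equiv _ idx.symm
  constructor
  · intro hP
    obtain ⟨r, t, hr⟩ := hP.exists_isRank
    exact h.gradedSeq_of_isRank hr
  · exact fun hg => (h.isRank_of_gradedSeq hg).isGraded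

end Graded

/-! ### Reading a sequence term by term -/

/-- The continuations of length `s` of a sequence with `N` terms whose last level starts at `L`,
whose last term is `L - k` and whose last `c` terms are the ones equal to `L`. -/
def words : (s L k c N : ℕ) → Finset (List ℕ)
  | 0, _, k, _, _ => if k = 0 then {[]} else ∅
  | s + 1, L, k, c, N =>
    ((Finset.range (k + 1)).biUnion fun k' =>
      (words s L k' (if k' = 0 then c + 1 else 0) (N + 1)).image (List.cons (L - k'))) ∪
    (Finset.range (if k = 0 then c else 0)).biUnion fun k' =>
      (words s N k' (if k' = 0 then 1 else 0) (N + 1)).image (List.cons (N - k'))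

theorem nil_mem_words {L k c N : ℕ} : [] ∈ words 0 L k c N ↔ k = 0 := by
  rw [words]
  split_ifs <;> simp [*]

theorem cons_mem_words {s L k c N v : ℕ} {w : List ℕ} :
    v :: w ∈ words (s + 1) L k c N ↔
      (∃ k' ≤ k, v = L - k' ∧ w ∈ words s L k' (if k' = 0 then c + 1 else 0) (N + 1)) ∨
      (k = 0 ∧ ∃ k' < c, v = N - k' ∧ w ∈ words s N k' (if k' = 0 then 1 else 0) (N + 1)) := by
  rw [words]
  simp only [Finset.mem_union, Finset.mem_biUnion, Finset.mem_range, Finset.mem_image,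
    List.cons.injEq, Nat.lt_succ_iff]
  by_cases hk : k = 0
  · simp only [hk, if_true, true_and]
    aesop
  · simp only [hk, if_false, false_and, or_false, not_lt_zero]
    aesop

theorem length_of_mem_words {s L k c N : ℕ} {l : List ℕ} (h : l ∈ words s L k c N) :
    l.length = s := by
  induction s generalizing L k c N l with
  | zero =>
    rw [words] at h
    split_ifs at h <;> simp_all
  | succ s ih =>
    simp only [words, Finset.mem_union, Finset.mem_biUnion, Finset.mem_image] at h
    rcases h with ⟨_, _, w, hw, rfl⟩ | ⟨_, _, w, hw, rfl⟩ <;> simp [ih hw]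

theorem words_bounds {s L k c N : ℕ} {l : List ℕ} (hkL : k ≤ L) (hL : L + c ≤ N)
    (h : l ∈ words s L k c N) :
    (∀ x ∈ l, L - k ≤ x) ∧ l.Pairwise (· ≤ ·) ∧ ∀ i (hi : i < l.length), l[i] ≤ N + i := by
  induction s generalizing L k c N l with
  | zero =>
    obtain rfl := List.length_eq_zero_iff.1 (length_of_mem_words h)
    simp
  | succ s ih =>
    obtain _ | ⟨v, w⟩ := l
    · exact absurd (length_of_mem_words h) (by simp)
    rw [cons_mem_words] at h
    have aux (hv : L - k ≤ v) (hvN : v ≤ N) (hw : (∀ x ∈ w, v ≤ x) ∧ w.Pairwise (· ≤ ·) ∧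
        ∀ i (hi : i < w.length), w[i] ≤ N + 1 + i) : (∀ x ∈ v :: w, L - k ≤ x) ∧
        (v :: w).Pairwise (· ≤ ·) ∧ ∀ i (hi : i < (v :: w).length), (v :: w)[i] ≤ N + i := by
      refine ⟨?_, List.pairwise_cons.2 ⟨hw.1, hw.2.1⟩, ?_⟩
      · simp only [List.mem_cons, forall_eq_or_imp]
        exact ⟨hv, fun x hx => hv.trans (hw.1 x hx)⟩
      · rintro (_ | i) hi
        · simpa using hvN
        · have := hw.2.2 i (by simpa using hi)
          simp only [List.getElem_cons_succ]
          omega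
    rcases h with ⟨k', hk', rfl, hw⟩ | ⟨rfl, k', hk', rfl, hw⟩
    · refine aux (by omega) (by omega) (ih (by omega) ?_ hw)
      split_ifs <;> omega
    · refine aux (by omega) (by omega) (ih (by omega) ?_ hw)
      split_ifs <;> omega

/-- The state of the automaton behind `words` after it has read the first `N` terms of `F`. -/
structure State (F : ℕ → ℕ) (L k c N : ℕ) : Prop where
  k_le : k ≤ L
  k_lt : 0 < k → k < L
  c_le : L + c ≤ N
  start_lt : 0 < N → L < N
  val_last : 0 < N → F (N - 1) = L - k
  le_start : ∀ j < N, F j ≤ L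
  eq_start_iff : ∀ j < N, F j = L ↔ N ≤ j + c
  lvl_lt : ∀ j < L, lvl F j < lvl F L
  lvl_eq : ∀ j < N, L ≤ j → lvl F j = lvl F L
  lvl_prev : ∀ j < L, L - k ≤ j + 1 → lvl F j + 1 = lvl F L
  flat : ∀ v, 0 < v → L - k ≤ v → v ≤ L → Flat F v


section Automaton

variable {F : ℕ → ℕ} {L k c N : ℕ}

theorem state_zero (F : ℕ → ℕ) : State F 0 0 0 0 := by
  constructor <;> intros <;> omega

/-- A positive new term `v` has `v - 1` in the stretch just below `L` where levels are one less than
at `L`, so the new element joins the current level. -/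
theorem State.stay (hm : Monotone F) (hF : ∀ i, F i ≤ i) (h : State F L k c N) {k' : ℕ}
    (hk : k' ≤ k) (hv : F N = L - k') :
    State F L k' (if k' = 0 then c + 1 else 0) (N + 1) := by
  have h1 := h.k_le
  have h2 := h.c_le
  refine ⟨by omega, fun h0 => ?_, ?_, by omega, fun _ => ?_, fun j hj => ?_, fun j hj => ?_, h.lvl_lt,
    fun j hj hLj => ?_, fun j hj hjk => h.lvl_prev j hj (by omega),
    fun v h0 hv1 => h.flat v h0 (by omega)⟩
  · have := h.k_lt (by omega)
    omega
  · split_ifs <;> omega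
  · simpa using hv
  · rcases Nat.lt_succ_iff_lt_or_eq.1 hj with hj | rfl
    · exact h.le_start j hj
    · omega
  · rcases Nat.lt_succ_iff_lt_or_eq.1 hj with hj | rfl
    · have h3 := h.eq_start_iff j hj
      have h4 := hm hj.le
      split_ifs <;> omega
    · split_ifs <;> omega
  · rcases Nat.lt_succ_iff_lt_or_eq.1 hj with hj | rfl
    · exact h.lvl_eq j hj hLj
    · rcases Nat.eq_zero_or_pos (F j) with h0 | h0
      · have h3 : L = 0 := by
          by_contra h3
          have := h.k_lt (by omega)
          omega
        subst h3
        rw [lvl_of_eq_zero h0, lvl_of_eq_zero (Nat.le_zero.1 (hF 0))]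
      · rw [lvl_of_pos hF h0, h.lvl_prev _ (by omega) (by omega)]

/-- Element `N` opens a new level. Since `k' < c`, every `v` from `N - k'` to `N` has `F (v - 1) =
L`, which keeps these prefixes flat. -/
theorem State.up (hF : ∀ i, F i ≤ i) (h : State F L 0 c N) {k' : ℕ}
    (hk : k' < c) (hv : F N = N - k') :
    State F N k' (if k' = 0 then 1 else 0) (N + 1) := by
  have h2 := h.c_le
  have hN : lvl F N = lvl F L + 1 := by
    rw [lvl_of_pos hF (by omega), h.lvl_eq _ (by omega) (by omega)]
  refine ⟨by omega, by omega, ?_, by omega, fun _ => ?_, fun j hj => ?_, fun j hj => ?_, fun j hj => ?_,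
    fun j hj hLj => ?_, fun j hj hjk => ?_, fun v h0 hv1 hv2 => ?_⟩
  · split_ifs <;> omega
  · simpa using hv
  · exact (hF j).trans (by omega)
  · rcases Nat.lt_succ_iff_lt_or_eq.1 hj with hj | rfl
    · have h3 := h.le_start j hj
      split_ifs <;> omega
    · split_ifs <;> omega
  · rcases lt_or_ge j L with hjL | hjL
    · have := h.lvl_lt j hjL
      omega
    · have := h.lvl_eq j hj hjL
      omega
  · rw [show j = N by omega]
  · rw [hN, h.lvl_eq j hj (by omega)]
  · rw [Flat, (h.eq_start_iff (v - 1) (by omega)).2 (by omega), h.lvl_eq (v - 1) (by omega)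
      (by omega)]

theorem State.mem_words_iff (hm : Monotone F) (hF : ∀ i, F i ≤ i) (s : ℕ)
    (h : State F L k c N) :
    (List.range' N s).map F ∈ words s L k c N ↔
      (∀ i, N ≤ i → i < N + s → 0 < F i → Flat F (F i)) ∧ (0 < N + s → Flat F (N + s)) := by
  induction s generalizing L k c N with
  | zero =>
    have h1 := h.k_le
    have h2 := h.c_le
    simp only [List.range'_zero, List.map_nil, nil_mem_words, Nat.add_zero]
    constructor
    · rintro rfl
      refine ⟨by omega, fun h0 => ?_⟩
      have h3 := h.val_last h0
      have h4 := hF (N - 1)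
      rw [Flat, h3, h.lvl_eq (N - 1) (by omega) (by omega), Nat.sub_zero]
    · rintro ⟨-, hfl⟩
      by_contra hk
      -- If `k > 0`, the last term `L - k` is an index of lower level than `N - 1`, so the full
      -- sequence is not flat.
      have h3 := hfl (by omega)
      have h4 := h.lvl_lt (L - k) (by omega)
      have h5 := h.start_lt (by omega)
      rw [Flat, h.val_last (by omega), h.lvl_eq (N - 1) (by omega) (by omega)] at h3
      omega
  | succ s ih =>
    have h1 := h.k_le
    have h2 := h.c_le
    have hsplit : (∀ i, N ≤ i → i < N + (s + 1) → 0 < F i → Flat F (F i)) ↔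
        (0 < F N → Flat F (F N)) ∧
          ∀ i, N + 1 ≤ i → i < N + 1 + s → 0 < F i → Flat F (F i) := by
      constructor
      · exact fun H => ⟨H N le_rfl (by omega), fun i hi hi' => H i (by omega) (by omega)⟩
      · rintro ⟨H1, H2⟩ i hi hi'
        rcases eq_or_lt_of_le hi with rfl | hlt
        · exact H1
        · exact H2 i hlt (by omega)
    rw [List.range'_succ, List.map_cons, cons_mem_words, hsplit, and_assoc,
      show N + (s + 1) = N + 1 + s by omega]
    constructor
    · rintro (⟨k', hk', hv, hw⟩ | ⟨rfl, k', hk', hv, hw⟩)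
      · refine ⟨fun h0 => h.flat _ h0 (by omega) (by omega), ?_⟩
        exact (ih (h.stay hm hF hk' hv)).1 hw
      · have hst := h.up hF hk' hv
        refine ⟨fun h0 => hst.flat _ h0 (by omega) (by omega), ?_⟩
        exact (ih hst).1 hw
    · rintro ⟨hfl, hrest⟩
      have hlast : L - k ≤ F N := by
        rcases Nat.eq_zero_or_pos N with rfl | h0
        · omega
        · rw [← h.val_last h0]
          exact hm (Nat.sub_le N 1)
      have hFN := hF N
      rcases le_or_gt (F N) L with hle | hlt
      · have hv : F N = L - (L - F N) := by omega
        exact Or.inl ⟨L - F N, by omega, hv, (ih (h.stay hm hF (by omega) hv)).2 hrest⟩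
      -- A value beyond `L` is flat only if `F (F N - 1) = L`. Then `F N - 1` is among the last `c`
      -- indices, and monotonicity forces `k = 0`.
      · have h3 := hfl (by omega)
        rw [Flat, h.lvl_eq (F N - 1) (by omega) (by omega)] at h3
        have h4 : F (F N - 1) = L := by
          refine le_antisymm (h.le_start _ (by omega)) (le_of_not_gt fun h4 => ?_)
          exact absurd h3 (h.lvl_lt _ h4).ne
        have h5 := (h.eq_start_iff (F N - 1) (by omega)).1 h4
        have h6 := h.val_last (by omega)
        have h7 := h.le_start (N - 1) (by omega)
        have h8 := hm (a := F N - 1) (b := N - 1) (by omega)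
        obtain rfl : k = 0 := by omega
        have hv : F N = N - (N - F N) := by omega
        exact Or.inr ⟨rfl, N - F N, by omega, hv, (ih (h.up hF (by omega) hv)).2 hrest⟩

end Automaton


/-! ### Generating functions of the states -/

section Counting

theorem card_words_zero (L k c N : ℕ) : (words 0 L k c N).card = if k = 0 then 1 else 0 := by
  rw [words]
  split_ifs <;> simp

/-- The unions are disjoint because first letters differ: `k ≤ L` separates the values `L - k'`, and
`k' < c ≤ N - L` puts the values `N - k'` above `L`. -/
theorem card_words_succ {s L k c N : ℕ} (hkL : k ≤ L) (hL : L + c ≤ N) :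
    (words (s + 1) L k c N).card =
      (∑ k' ∈ Finset.range (k + 1),
        (words s L k' (if k' = 0 then c + 1 else 0) (N + 1)).card) +
      ∑ k' ∈ Finset.range (if k = 0 then c else 0),
        (words s N k' (if k' = 0 then 1 else 0) (N + 1)).card := by
  have hc : (if k = 0 then c else 0) ≤ c := by split_ifs <;> omega
  rw [words, Finset.card_union_of_disjoint, Finset.card_biUnion, Finset.card_biUnion]
  · simp only [Finset.card_image_of_injective _ (List.cons_injective)]
  · intro i hi j hj hij
    rw [Finset.mem_coe, Finset.mem_range] at hi hj
    simp only [Function.onFun, Finset.disjoint_left, Finset.mem_image, not_exists, not_and]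
    rintro _ ⟨w, hw, rfl⟩ w' hw' heq
    have := (List.cons.inj heq).1
    omega
  · intro i hi j hj hij
    rw [Finset.mem_coe, Finset.mem_range] at hi hj
    simp only [Function.onFun, Finset.disjoint_left, Finset.mem_image, not_exists, not_and]
    rintro _ ⟨w, hw, rfl⟩ w' hw' heq
    have := (List.cons.inj heq).1
    omega
  · simp only [Finset.disjoint_left, Finset.mem_biUnion, Finset.mem_image, Finset.mem_range,
      not_exists, not_and]
    rintro _ ⟨i, hi, w, hw, rfl⟩ j hj w' hw' heq
    have := (List.cons.inj heq).1
    omega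

open PowerSeries

variable {u E : ℚ⟦X⟧}

theorem plateau_series_eq (hu : u * (1 - X) = 1) (c : ℕ) :
    u + X * u ^ c * E = 1 + X * (1 - 2 * X) * u ^ (c + 1) * E + X * (u + X * u ^ (c + 1) * E) := by
  rw [pow_succ]
  linear_combination (1 - X * u ^ c * E) * hu

/-- The bracket sums `completions` over all `k' ≤ k`, with `c = 1` at `k' = 0`. It serves both for
staying in a state with `k > 0` and for jumping to a new level. -/
theorem staircase_series_eq (hu : u * (1 - X) = 1) (hE : E * (1 - 3 * X + X ^ 2) = 1) (k : ℕ) :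
    X * (1 - 2 * X) * u ^ (k + 1) * E =
      X * (u + X * E + ∑ i ∈ Finset.range k, X * (1 - 2 * X) * u ^ (i + 2) * E) := by
  induction k with
  | zero =>
    simp only [Finset.range_zero, Finset.sum_empty]
    linear_combination X * u * hE + X ^ 2 * E * hu
  | succ k ih =>
    rw [Finset.sum_range_succ]
    linear_combination ih + X * (1 - 2 * X) * u ^ (k + 1) * E * hu

/-- The generating function of `words s L k c N`, where `u` and `E` are the inverses of `1 - X` and
`1 - 3 X + X ^ 2`. -/
noncomputable def completions (u E : ℚ⟦X⟧) (k c : ℕ) : ℚ⟦X⟧ :=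
  if k = 0 then u + X * u ^ (c - 1) * E else X * (1 - 2 * X) * u ^ (k + 1) * E

theorem coeff_zero_completions (hu : u * (1 - X) = 1) (k c : ℕ) :
    coeff 0 (completions u E k c) = if k = 0 then 1 else 0 := by
  have h1 : constantCoeff u = 1 := by simpa using congrArg constantCoeff hu
  rw [completions]
  split_ifs <;> simp [h1]

theorem coeff_succ_completions (hu : u * (1 - X) = 1) (hE : E * (1 - 3 * X + X ^ 2) = 1)
    (s k c : ℕ) (hc : k = 0 → 0 < c) (hk : 0 < k → c = 0) :
    coeff (s + 1) (completions u E k c) =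
      (∑ k' ∈ Finset.range (k + 1),
        coeff s (completions u E k' (if k' = 0 then c + 1 else 0))) +
      ∑ k' ∈ Finset.range (if k = 0 then c else 0),
        coeff s (completions u E k' (if k' = 0 then 1 else 0)) := by
  simp only [← map_sum]
  rw [← map_add, ← coeff_succ_X_mul s]
  have hsum (k : ℕ) : ∑ k' ∈ Finset.range (k + 1), completions u E k' (if k' = 0 then 1 else 0) =
      u + X * E + ∑ i ∈ Finset.range k, X * (1 - 2 * X) * u ^ (i + 2) * E := by
    rw [Finset.sum_range_succ', add_comm]
    simp [completions]
  rcases Nat.eq_zero_or_pos k with rfl | hk0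
  · obtain ⟨d, rfl⟩ := Nat.exists_eq_add_of_lt (hc rfl)
    have h1 := plateau_series_eq (E := E) hu d
    have h2 := staircase_series_eq hu hE d
    have h3 : completions u E 0 (0 + d + 1) = 1 + X * (∑ k' ∈ Finset.range (0 + 1),
        completions u E k' (if k' = 0 then 0 + d + 1 + 1 else 0) +
        ∑ k' ∈ Finset.range (if 0 = 0 then 0 + d + 1 else 0),
          completions u E k' (if k' = 0 then 1 else 0)) := by
      rw [if_pos rfl, zero_add d, hsum]
      simp only [completions, Finset.sum_range_succ, Finset.sum_range_zero, if_true,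
        Nat.add_sub_cancel]
      linear_combination h1 + h2
    rw [h3, map_add, coeff_one, if_neg (by omega), zero_add]
  · obtain rfl := hk hk0
    rw [if_neg hk0.ne', Finset.sum_range_zero, add_zero, zero_add, hsum, ← staircase_series_eq hu hE,
      completions, if_neg hk0.ne']

theorem card_words_eq_coeff (hu : u * (1 - X) = 1) (hE : E * (1 - 3 * X + X ^ 2) = 1)
    {s L k c N : ℕ} (hkL : k ≤ L) (hL : L + c ≤ N) (hc : k = 0 → 0 < c) (hk : 0 < k → c = 0) :
    ((words s L k c N).card : ℚ) = coeff s (completions u E k c) := by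
  induction s generalizing L k c N with
  | zero => rw [card_words_zero, coeff_zero_completions hu]; split_ifs <;> simp
  | succ s ih =>
    rw [card_words_succ hkL hL, coeff_succ_completions hu hE s k c hc hk]
    push_cast
    congr 1 <;> refine Finset.sum_congr rfl fun k' hk' => ?_ <;> rw [Finset.mem_range] at hk'
    · apply ih <;> (try split_ifs) <;> omega
    · have hk'c : k' < c := by split_ifs at hk' <;> omega
      apply ih <;> (try split_ifs) <;> omega

/-- The initial state has `k = c = 0`, which the closed formula excludes; the first term is forced
to be 0 and leads to `c = 1`. -/
theorem card_words_start (n : ℕ) :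
    (words (n + 1) 0 0 0 0).card = (words n 0 0 1 1).card := by
  rw [card_words_succ le_rfl le_rfl]
  simp

theorem mk_card_words (hu : u * (1 - X) = 1) (hE : E * (1 - 3 * X + X ^ 2) = 1) :
    (PowerSeries.mk fun n => ((words n 0 0 0 0).card : ℚ)) = 1 + X * (u + X * E) := by
  ext n
  rw [coeff_mk]
  cases n with
  | zero => simp [card_words_zero]
  | succ n =>
    rw [card_words_start, card_words_eq_coeff hu hE (by omega) (by omega) (by omega) (by omega),
      map_add, coeff_one, if_neg (by omega), zero_add, coeff_succ_X_mul]
    simp [completions]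

end Counting


/-! ### Words and isomorphism classes -/

/-- The order on `{0, …, n - 1}` in which `x` is below `y` when `x < F y`. -/
abbrev seqOrder (F : ℕ → ℕ) (hF : ∀ i, F i ≤ i) (n : ℕ) : PartialOrder (Fin n) where
  le x y := x = y ∨ (x : ℕ) < F y
  lt x y := (x : ℕ) < F y
  le_refl x := Or.inl rfl
  le_trans x y z := by
    rintro (rfl | hxy) (rfl | hyz)
    · exact Or.inl rfl
    · exact Or.inr hyz
    · exact Or.inr hxy
    · have := hF y
      exact Or.inr (by omega)
  le_antisymm x y := by
    rintro (rfl | hxy) (h | hyx)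
    · rfl
    · rfl
    · exact h.symm
    · have := hF x
      have := hF y
      omega
  lt_iff_le_not_ge x y := by
    have := hF x
    have := hF y
    constructor
    · refine fun h => ⟨Or.inr h, ?_⟩
      rintro (rfl | h') <;> omega
    · rintro ⟨rfl | h, h'⟩
      · exact absurd (Or.inl rfl) h'
      · exact h

theorem isRep_seqOrder (F : ℕ → ℕ) (hm : Monotone F) (hF : ∀ i, F i ≤ i) (n : ℕ) :
    @IsRep (Fin n) (seqOrder F hF n) n (Equiv.refl _) F :=
  @IsRep.mk (Fin n) (seqOrder F hF n) n (Equiv.refl _) F hm hF fun _ _ => Iff.rfl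

/-- An isomorphism preserves the sizes of strict lower sets, and a finite family has only one
monotone rearrangement. -/
theorem IsRep.eq_of_orderIso {P Q : Type*} [PartialOrder P] [PartialOrder Q] {n : ℕ}
    {idx : P ≃ Fin n} {idx' : Q ≃ Fin n} {F G : ℕ → ℕ} (hF : IsRep idx F) (hG : IsRep idx' G)
    (e : P ≃o Q) {i : ℕ} (hi : i < n) : F i = G i := by
  let σ : Equiv.Perm (Fin n) := (idx.symm.trans e.toEquiv).trans idx'
  have hFG (j : Fin n) : F j = G (σ j) := by
    have h1 := hF.ncard_Iio (idx.symm j)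
    have h2 := hG.ncard_Iio (e (idx.symm j))
    rw [← e.image_Iio, Set.ncard_image_of_injective _ e.injective, h1] at h2
    simpa [σ] using h2
  have h1 : (fun j : Fin n => G j) ∘ σ = (fun j : Fin n => G j) ∘ (1 : Equiv.Perm (Fin n)) := by
    refine Tuple.unique_monotone (fun a b hab => ?_) fun a b hab => hG.mono hab
    simp only [Function.comp_apply, ← hFG]
    exact hF.mono hab
  exact (hFG ⟨i, hi⟩).trans (congrFun h1 ⟨i, hi⟩)

theorem IsRep.nonempty_orderIso {P Q : Type*} [PartialOrder P] [PartialOrder Q] {n : ℕ}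
    {idx : P ≃ Fin n} {idx' : Q ≃ Fin n} {F : ℕ → ℕ} (hP : IsRep idx F) (hQ : IsRep idx' F) :
    Nonempty (P ≃o Q) := by
  refine ⟨⟨idx.trans idx'.symm, fun {a b} => ?_⟩⟩
  rw [le_iff_eq_or_lt, le_iff_eq_or_lt, hP.lt_iff, hQ.lt_iff]
  simp

/-- The sequence `l`, continued by the identity. -/
def extend (l : List ℕ) (i : ℕ) : ℕ :=
  l.getD i i

section Extend

variable {n : ℕ} {l : List ℕ}

theorem extend_le_self (h : l ∈ words n 0 0 0 0) (i : ℕ) : extend l i ≤ i := by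
  have hb := words_bounds le_rfl le_rfl h
  rw [extend]
  rcases lt_or_ge i l.length with hi | hi
  · rw [List.getD_eq_getElem _ _ hi]
    simpa using hb.2.2 i hi
  · rw [List.getD_eq_default _ _ hi]

theorem extend_mono (h : l ∈ words n 0 0 0 0) : Monotone (extend l) := by
  have hb := words_bounds le_rfl le_rfl h
  intro i j hij
  rcases lt_or_ge j l.length with hj | hj
  · rw [extend, extend, List.getD_eq_getElem _ _ hj, List.getD_eq_getElem _ _ (hij.trans_lt hj)]
    rcases eq_or_lt_of_le hij with rfl | hij
    · exact le_rfl
    · exact List.pairwise_iff_getElem.1 hb.2.1 i j _ hj hij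
  · refine (extend_le_self h i).trans ?_
    rwa [extend, List.getD_eq_default _ _ hj]

theorem map_extend_range' (h : l.length = n) : (List.range' 0 n).map (extend l) = l := by
  subst h
  refine List.ext_getElem (by simp) fun i h1 h2 => ?_
  simp [extend, h2]

theorem gradedSeq_iff {F : ℕ → ℕ} (hm : Monotone F) (hF : ∀ i, F i ≤ i) :
    GradedSeq F n ↔ (List.range' 0 n).map F ∈ words n 0 0 0 0 := by
  rw [(state_zero F).mem_words_iff hm hF, GradedSeq]
  simp

theorem IsSemiorder.exists_word {P : Type*} [PartialOrder P] (e : P ≃ Fin n)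
    (hP : IsSemiorder P) (hg : IsGraded P) :
    ∃ l ∈ words n 0 0 0 0, ∃ idx : P ≃ Fin n, IsRep idx (extend l) := by
  obtain ⟨idx, F, hrep, hid⟩ := hP.exists_isRep e
  refine ⟨_, (gradedSeq_iff hrep.mono hrep.le_self).1 (hrep.isGraded_iff.1 hg), idx, ?_⟩
  convert hrep
  ext i
  rw [extend]
  rcases lt_or_ge i n with hi | hi
  · simp [hi]
  · simp [not_lt.2 hi, hid i hi]

/-- The graded semiorder described by a word. -/
def ofWord (n : ℕ) (l : {l // l ∈ words n 0 0 0 0}) : Labeled n :=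
  have hm := extend_mono l.2
  have hF := extend_le_self l.2
  ⟨seqOrder (extend l.1) hF n,
    (@IsRep.isGraded_iff (Fin n) (seqOrder _ hF n) n _ _ (isRep_seqOrder _ hm hF n)).2
      ((gradedSeq_iff hm hF).2 (by
        rw [map_extend_range' (length_of_mem_words l.2)]
        exact l.2)),
    @IsRep.isSemiorder (Fin n) (seqOrder _ hF n) n _ _ (isRep_seqOrder _ hm hF n)⟩

end Extend

theorem ofWord_bijective (n : ℕ) :
    Function.Bijective fun l => (Quotient.mk (isoSetoid n) (ofWord n l)) := by
  constructor
  · rintro ⟨l, hl⟩ ⟨l', hl'⟩ h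
    obtain ⟨e⟩ : Nonempty _ := Quotient.exact h
    have hrep := isRep_seqOrder _ (extend_mono hl) (extend_le_self hl) n
    have hrep' := isRep_seqOrder _ (extend_mono hl') (extend_le_self hl') n
    apply Subtype.ext
    change l = l'
    rw [← map_extend_range' (length_of_mem_words hl), ← map_extend_range' (length_of_mem_words hl')]
    refine List.map_congr_left fun i hi => ?_
    exact @IsRep.eq_of_orderIso (Fin n) (Fin n) (seqOrder _ _ n) (seqOrder _ _ n) n _ _ _ _
      hrep hrep' e i (by simpa using hi)
  · intro q
    induction q using Quotient.inductionOn with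
    | _ p =>
    obtain ⟨l, hl, idx, hrep⟩ :=
      @IsSemiorder.exists_word n (Fin n) p.1 (Equiv.refl _) p.2.2 p.2.1
    exact ⟨⟨l, hl⟩, Quotient.sound (@IsRep.nonempty_orderIso (Fin n) (Fin n) (seqOrder _ _ n) p.1
      n _ _ _ (isRep_seqOrder _ (extend_mono hl) (extend_le_self hl) n) hrep)⟩

theorem numUnlabeled_eq (n : ℕ) : numUnlabeled n = (words n 0 0 0 0).card := by
  rw [numUnlabeled, Unlabeled, ← Nat.card_eq_of_bijective _ (ofWord_bijective n)]
  simp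

end GradedSemiorder

theorem mainTheorem2 :
    GradedSemiorder.ogf =
      (1 - 3 * PowerSeries.X + 2 * PowerSeries.X ^ 2 - PowerSeries.X ^ 3) *
        ((1 - PowerSeries.X) * (1 - 3 * PowerSeries.X + PowerSeries.X ^ 2))⁻¹ := by
  have hu : (1 - PowerSeries.X : PowerSeries ℚ)⁻¹ * (1 - PowerSeries.X) = 1 :=
    PowerSeries.inv_mul_cancel _ (by simp)
  have hE : (1 - 3 * PowerSeries.X + PowerSeries.X ^ 2 : PowerSeries ℚ)⁻¹ *
      (1 - 3 * PowerSeries.X + PowerSeries.X ^ 2) = 1 :=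
    PowerSeries.inv_mul_cancel _ (by simp)
  rw [PowerSeries.eq_mul_inv_iff_mul_eq (by simp), GradedSemiorder.ogf]
  simp only [GradedSemiorder.numUnlabeled_eq]
  rw [GradedSemiorder.mk_card_words hu hE]
  linear_combination PowerSeries.X * (1 - 3 * PowerSeries.X + PowerSeries.X ^ 2) * hu +
    PowerSeries.X ^ 2 * (1 - PowerSeries.X) * hE
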